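/- For $\mu\in\mathbb C$ and $\operatorname{Re} z>0$ let $K_\mu(z)=\int_0^\infty e^{-z\cosh y}\cosh(\mu y)\,dy$, and let the Kelvin functions $\mathrm{ker}_\mu,\mathrm{kei}_\mu$ be defined for $x>0$ by $\mathrm{ker}_\mu(x)\pm i\,\mathrm{kei}_\mu(x)=e^{\mp\mu\pi i/2}K_\mu(xe^{\pm\pi i/4})$. For $f:(0,\infty)\to\mathbb C$ and $\tau\in\mathbb R$ put $$(Ff)(\tau)=\int_0^\infty\left[\mathrm{ker}_{2i\tau}^2\big(2(4x)^{1/4}\big)+\mathrm{kei}_{2i\tau}^2\big(2(4x)^{1/4}\big)\right]f(x)\,dx .$$ For $\nu\in\mathbb R$ and $1\le p<\infty$ let $L_{\nu,p}(\mathbb R_+)$ be the space of (classes of) measurable $f:(0,\infty)\to\mathbb C$ with $\|f\|_{\nu,p}=\left(\int_0^\infty|f(x)|^p x^{\nu p-1}dx\right)^{1/p}<\infty$. **Theorem 2.** Let $1\le p<\infty$, $q=p/(p-1)$ ($q=\infty$ if $p=1$) and $\nu<1$. For every $f\in L_{\nu,p}(\mathbb R_+)$ the integral $(Ff)(\tau)$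 converges absolutely for every $\tau\in\mathbb R$, and $F$ is a bounded linear operator from $L_{\nu,p}(\mathbb R_+)$ into the space of bounded continuous complex-valued functions of $\tau\in\mathbb R$ with the supremum norm (hence, by restriction, into $C_b(\mathbb R_+)$), with $$\sup_{\tau}|(Ff)(\tau)|\le 4^{\nu-3+1/q}\,q^{4(\nu-1)}\,\Gamma\big(4(1-\nu)q\big)^{1/q}\,B(1-\nu,1-\nu)\,B\big(2(1-\nu),2(1-\nu)\big)\,\|f\|_{\nu,p},$$ where $\Gamma$ and $B$ are Euler's gamma and beta functions. For $p=1$ one takes $1/q=0$, and the factor $q^{4(\nu-1)}\Gamma(4(1-\nu)q)^{1/q}$ is understood as its limit as $q\to\infty$, namely $\left(\frac{4(1-\nu)}{e}\right)^{4(1-\nu)}$. Moreover, $(Ff)(\tau)\to0$ as $\tau\to+\infty$. -/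

import Mathlib

open MeasureTheory Set Filter Topology
open scoped ENNReal BoundedContinuousFunction

noncomputable section

/-- The modified Bessel function of the second kind, `K_μ(z) = ∫₀^∞ e^{-z cosh y} cosh(μ y) dy`,
for complex order `μ` and `Re z > 0` (it is only used in that half-plane). -/
def besselK (μ z : ℂ) : ℂ :=
  ∫ y in Ioi (0 : ℝ), Complex.exp (-z * Complex.cosh (y : ℂ)) * Complex.cosh (μ * (y : ℂ))

/-- `e^{-μπi/2} K_μ(x e^{πi/4})`, which is `ker_μ(x) + i kei_μ(x)`. -/
def kelvinPlus (μ : ℂ) (x : ℝ) : ℂ :=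
  Complex.exp (-(μ * Real.pi * Complex.I / 2)) *
    besselK μ ((x : ℂ) * Complex.exp (Real.pi * Complex.I / 4))

/-- `e^{μπi/2} K_μ(x e^{-πi/4})`, which is `ker_μ(x) - i kei_μ(x)`. -/
def kelvinMinus (μ : ℂ) (x : ℝ) : ℂ :=
  Complex.exp (μ * Real.pi * Complex.I / 2) *
    besselK μ ((x : ℂ) * Complex.exp (-(Real.pi * Complex.I / 4)))

/-- The Kelvin function `ker_μ(x)`, of complex order `μ`, for `x > 0`. -/
def kelvinKer (μ : ℂ) (x : ℝ) : ℂ :=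
  (kelvinPlus μ x + kelvinMinus μ x) / 2

/-- The Kelvin function `kei_μ(x)`, of complex order `μ`, for `x > 0`. -/
def kelvinKei (μ : ℂ) (x : ℝ) : ℂ :=
  (kelvinPlus μ x - kelvinMinus μ x) / (2 * Complex.I)

/-- `ker_μ` and `kei_μ` satisfy the two equations that define them. -/
theorem kelvin_defining_equations (μ : ℂ) (x : ℝ) :
    kelvinKer μ x + Complex.I * kelvinKei μ x = kelvinPlus μ x ∧
      kelvinKer μ x - Complex.I * kelvinKei μ x = kelvinMinus μ x := by
  have hI : Complex.I ≠ 0 := Complex.I_ne_zero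
  unfold kelvinKer kelvinKei
  constructor <;> field_simp <;> ring

/-- The kernel `ker²_{2iτ}(2 (4x)^{1/4}) + kei²_{2iτ}(2 (4x)^{1/4})`. -/
def kelvinKernel (x τ : ℝ) : ℂ :=
  kelvinKer (2 * Complex.I * (τ : ℂ)) (2 * (4 * x) ^ (1 / 4 : ℝ)) ^ 2 +
    kelvinKei (2 * Complex.I * (τ : ℂ)) (2 * (4 * x) ^ (1 / 4 : ℝ)) ^ 2

/-- The index transform
`(F f)(τ) = ∫₀^∞ [ker²_{2iτ}(2 (4x)^{1/4}) + kei²_{2iτ}(2 (4x)^{1/4})] f(x) dx`. -/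
def indexTransform (f : ℝ → ℂ) (τ : ℝ) : ℂ :=
  ∫ x in Ioi (0 : ℝ), kelvinKernel x τ * f x

/-- The measure `x^{νp-1} dx` on `(0, ∞)`; the space `L_{ν,p}(ℝ₊)` is `L^p` of this measure. -/
def weightedMeasure (ν p : ℝ) : Measure ℝ :=
  (volume.restrict (Ioi (0 : ℝ))).withDensity fun x => ENNReal.ofReal (x ^ (ν * p - 1))

/-- The norm `‖f‖_{ν,p} = (∫₀^∞ |f(x)|^p x^{νp-1} dx)^{1/p}`. -/
def weightedNorm (ν p : ℝ) (f : ℝ → ℂ) : ℝ :=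
  (∫ x in Ioi (0 : ℝ), ‖f x‖ ^ p * x ^ (ν * p - 1)) ^ (1 / p)

/-- The factor `q^{4(ν-1)} Γ(4(1-ν)q)^{1/q}` with `q = p/(p-1)`. For `p = 1`, where `q = ∞`, it is
the limit of this expression as `q → ∞`, which by Stirling's formula is
`(4(1-ν)/e)^{4(1-ν)}`. -/
def gammaFactor (ν p : ℝ) : ℝ :=
  if p = 1 then (4 * (1 - ν) / Real.exp 1) ^ (4 * (1 - ν))
  else (p / (p - 1)) ^ (4 * (ν - 1)) *
    Real.Gamma (4 * (1 - ν) * (p / (p - 1))) ^ (1 / (p / (p - 1)))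

/-- The constant `4^{ν-3+1/q} q^{4(ν-1)} Γ(4(1-ν)q)^{1/q} B(1-ν,1-ν) B(2(1-ν),2(1-ν))`, where
`1/q = 1 - 1/p` and `B(a,b) = Γ(a)Γ(b)/Γ(a+b)` is Euler's beta function. -/
def boundConst (ν p : ℝ) : ℝ :=
  4 ^ (ν - 3 + (1 - 1 / p)) * gammaFactor ν p *
    ProbabilityTheory.beta (1 - ν) (1 - ν) * ProbabilityTheory.beta (2 * (1 - ν)) (2 * (1 - ν))

end

/-! Since `ker² + kei² = (ker + i kei)(ker - i kei)`, the kernel is a product of two values of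
`K_{2iτ}` at the conjugate points `s(1 ± i)`, `s = 2x^{1/4}`. Each factor is half a Fourier
transform, so the product is a quarter of the Fourier transform of a convolution. A contour shift
shows that this convolution is the nonnegative function `coshDensity s` (`integral_conj_product`,
`kelvinKernel_eq_integral`).

Positivity makes the kernel largest at `τ = 0`, which gives one majorant for all `τ`. Continuity and
decay of `Ff` then follow by dominated convergence, the decay using Riemann–Lebesgue for each `x`.

For the constant, Tonelli puts the `x`-integral inside. Hölder against `exp (-c x^{1/4})` with `c =
4 √(cosh u) cosh v` gives the gamma factor times `c^{-4(1-ν)}` (`lintegral_exp_mul_le`), and this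
power separates into two integrals of powers of `cosh`, which are beta values
(`lintegral_cosh_rpow_neg`). -/

/-! ### Integrals of `exp (-A cosh)` and the contour shift. -/

theorem Real.sq_div_two_le_cosh (y : ℝ) : y ^ 2 / 2 ≤ Real.cosh y := by
  have h1 : |y / 2| ≤ |Real.sinh (y / 2)| := by
    rw [Real.abs_sinh]
    exact Real.self_le_sinh_iff.2 (abs_nonneg _)
  have h2 : (y / 2) ^ 2 ≤ Real.sinh (y / 2) ^ 2 := sq_le_sq.2 h1
  have h3 := Real.cosh_two_mul (y / 2)
  have h4 := Real.cosh_sq (y / 2)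
  rw [show 2 * (y / 2) = y by ring] at h3
  linarith

theorem Complex.cosh_add_mul_I_eq (x y : ℝ) :
    Complex.cosh (x + y * Complex.I) =
      ((Real.cosh x * Real.cos y : ℝ) : ℂ) + ((Real.sinh x * Real.sin y : ℝ) : ℂ) * Complex.I := by
  rw [Complex.cosh_add, Complex.cosh_mul_I, Complex.sinh_mul_I]
  push_cast
  ring

theorem Complex.norm_exp_neg_mul_cosh (A x y : ℝ) :
    ‖Complex.exp (-((A : ℂ) * Complex.cosh (x + y * Complex.I)))‖ =
      Real.exp (-(A * Real.cos y * Real.cosh x)) := by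
  rw [Complex.norm_exp, Complex.cosh_add_mul_I_eq]
  congr 1
  rw [Complex.neg_re, Complex.re_ofReal_mul, Complex.add_re, Complex.ofReal_re,
    Complex.re_ofReal_mul, Complex.I_re]
  ring

theorem integrable_exp_neg_mul_cosh {c : ℝ} (hc : 0 < c) :
    Integrable fun y : ℝ => Real.exp (-(c * Real.cosh y)) := by
  refine (integrable_exp_neg_mul_sq (half_pos hc)).mono'
    (Continuous.aestronglyMeasurable (by fun_prop)) (ae_of_all _ fun y => ?_)
  rw [Real.norm_eq_abs, Real.abs_exp]
  apply Real.exp_le_exp.2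
  have := mul_le_mul_of_nonneg_left (Real.sq_div_two_le_cosh y) hc.le
  linarith

theorem tendsto_exp_neg_mul_cosh {c : ℝ} (hc : 0 < c) :
    Tendsto (fun y : ℝ => Real.exp (-(c * Real.cosh y))) atTop (𝓝 0) := by
  refine Real.tendsto_exp_neg_atTop_nhds_zero.comp (Tendsto.const_mul_atTop hc ?_)
  refine tendsto_atTop_mono Real.sq_div_two_le_cosh ?_
  exact (tendsto_pow_atTop two_ne_zero).atTop_div_const two_pos

/-- The value of `∫ exp (-A cosh)` along a horizontal line in the strip `|Im| < π/2` does not depend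
on the line. -/
theorem integral_exp_neg_mul_cosh_add_mul_I {A θ : ℝ} (hA : 0 < A) (hθ : |θ| < Real.pi / 2) :
    ∫ v : ℝ, Complex.exp (-((A : ℂ) * Complex.cosh (v + θ * Complex.I))) =
      ((∫ v : ℝ, Real.exp (-(A * Real.cosh v)) : ℝ) : ℂ) := by
  set F : ℂ → ℂ := fun w => Complex.exp (-((A : ℂ) * Complex.cosh w)) with hF
  have hFd : Differentiable ℂ F := by
    intro w
    exact (((Complex.differentiable_cosh w).const_mul (A : ℂ)).neg).cexp
  have hFc : Continuous F := hFd.continuous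
  have hcos : 0 < Real.cos θ := Real.cos_pos_of_mem_Ioo (abs_lt.1 hθ)
  have hint : ∀ y : ℝ, 0 < Real.cos y → Integrable fun x : ℝ => F (x + y * Complex.I) := by
    intro y hy
    refine (integrable_exp_neg_mul_cosh (mul_pos hA hy)).mono'
      (Continuous.aestronglyMeasurable (by fun_prop)) (ae_of_all _ fun x => ?_)
    rw [Complex.norm_exp_neg_mul_cosh]
  have hlim : ∀ y : ℝ, 0 < Real.cos y → Tendsto (fun T : ℝ => ∫ x in (-T)..T, F (x + y * Complex.I))
      atTop (𝓝 (∫ x : ℝ, F (x + y * Complex.I))) := fun y hy =>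
    intervalIntegral_tendsto_integral (hint y hy) tendsto_neg_atTop_atBot tendsto_id
  -- On the vertical sides the integrand has modulus `exp (-A cos y cosh T)`; this lower bound on
  -- `cos y`, for either sign of `θ`, makes both sides vanish as `T → ∞`.
  have hcosle : ∀ y ∈ Set.uIoc 0 θ, Real.cos θ ≤ Real.cos y := by
    intro y hy
    rw [← Real.cos_abs θ, ← Real.cos_abs y]
    have hyθ : |y| ≤ |θ| := by
      rcases Set.mem_uIoc.1 hy with h | h
      · rw [abs_of_pos h.1, abs_of_pos (h.1.trans_le h.2)]; exact h.2
      · rw [abs_of_nonpos h.2, abs_of_neg (h.1.trans_le h.2)]; linarith [h.1]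
    exact Real.cos_le_cos_of_nonneg_of_le_pi (abs_nonneg _) (by linarith [Real.pi_pos]) hyθ
  have hbound : ∀ s : ℝ, ∀ T : ℝ, |s| = |T| → ‖∫ y in (0 : ℝ)..θ, F (s + y * Complex.I)‖ ≤
      Real.exp (-(A * Real.cos θ * Real.cosh T)) * |θ - 0| := by
    intro s T hs
    refine intervalIntegral.norm_integral_le_of_norm_le_const fun y hy => ?_
    rw [Complex.norm_exp_neg_mul_cosh, ← Real.cosh_abs s, hs, Real.cosh_abs]
    apply Real.exp_le_exp.2
    have := mul_le_mul_of_nonneg_right (mul_le_mul_of_nonneg_left (hcosle y hy) hA.le)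
      (Real.cosh_pos T).le
    linarith
  have hside : ∀ s : ℝ → ℝ, (∀ T, |s T| = |T|) →
      Tendsto (fun T : ℝ => ∫ y in (0 : ℝ)..θ, F (s T + y * Complex.I)) atTop (𝓝 0) := by
    intro s hs
    refine squeeze_zero_norm (fun T => hbound (s T) T (hs T)) ?_
    simpa using (tendsto_exp_neg_mul_cosh (mul_pos hA hcos)).mul_const |θ - 0|
  have hrect : ∀ T : ℝ, (∫ x in (-T)..T, F (x + (0 : ℝ) * Complex.I)) -
      (∫ x in (-T)..T, F (x + θ * Complex.I)) +
      Complex.I * (∫ y in (0 : ℝ)..θ, F (T + y * Complex.I)) -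
      Complex.I * (∫ y in (0 : ℝ)..θ, F ((-T : ℝ) + y * Complex.I)) = 0 := by
    intro T
    simpa using Complex.integral_boundary_rect_eq_zero_of_differentiableOn F (-T)
      (T + θ * Complex.I) hFd.differentiableOn
  have hT := (((hlim 0 (by simp)).sub (hlim θ hcos)).add
    ((hside (fun T => T) fun _ => rfl).const_mul Complex.I)).sub
    ((hside (fun T => -T) fun T => abs_neg T).const_mul Complex.I)
  have h0 := tendsto_nhds_unique hT
    ((tendsto_congr hrect).2 tendsto_const_nhds)
  have h1 : ∫ x : ℝ, F (x + θ * Complex.I) = ∫ x : ℝ, F (x + (0 : ℝ) * Complex.I) := by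
    simp only [mul_zero, add_zero, sub_zero] at h0
    exact (sub_eq_zero.1 h0).symm
  rw [h1, ← integral_complex_ofReal]
  congr 1 with x
  simp [hF]

/-! ### Fourier representation of the Kelvin kernel. -/

theorem integrable_cexp_neg_mul_cosh_mul {z : ℂ} (hz : 0 < z.re) (β : ℝ) :
    Integrable fun y : ℝ => Complex.exp (-z * Complex.cosh y) * Complex.exp (β * y * Complex.I) := by
  refine (integrable_exp_neg_mul_cosh hz).mono'
    (Continuous.aestronglyMeasurable (by fun_prop)) (ae_of_all _ fun x => ?_)
  rw [norm_mul, Complex.norm_exp, ← Complex.ofReal_mul, Complex.norm_exp_ofReal_mul_I, mul_one,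
    ← Complex.ofReal_cosh, Complex.re_mul_ofReal]
  simp

/-- `cosh (iβy)` is the mean of `e^{±iβy}` and `cosh y` is even, so the half-line integral unfolds
to half of one over ℝ. -/
theorem besselK_eq_integral_real {z : ℂ} (hz : 0 < z.re) (β : ℝ) :
    besselK (Complex.I * β) z =
      (∫ y : ℝ, Complex.exp (-z * Complex.cosh y) * Complex.exp (β * y * Complex.I)) / 2 := by
  have hi := integrable_cexp_neg_mul_cosh_mul hz β
  have hi' := integrable_cexp_neg_mul_cosh_mul hz (-β)
  rw [← integral_add_compl measurableSet_Iic hi, compl_Iic]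
  have h1 : ∫ y in Iic (0 : ℝ), Complex.exp (-z * Complex.cosh y) * Complex.exp (β * y * Complex.I) =
      ∫ y in Ioi (0 : ℝ), Complex.exp (-z * Complex.cosh y) *
        Complex.exp ((-β : ℝ) * y * Complex.I) := by
    have := integral_comp_neg_Ioi (0 : ℝ) (fun y : ℝ =>
      Complex.exp (-z * Complex.cosh y) * Complex.exp (β * y * Complex.I))
    rw [neg_zero] at this
    rw [← this]
    congr 1 with y
    simp
  rw [h1, ← integral_add hi'.integrableOn hi.integrableOn, besselK, ← integral_div]
  congr 1 with y
  rw [Complex.cosh.eq_1 (Complex.I * β * y)]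
  push_cast
  rw [show Complex.I * β * y = β * y * Complex.I by ring,
    show -(β * y * Complex.I : ℂ) = -β * y * Complex.I by ring]
  ring

/-- Polar form of `cosh (u/2) + i sinh (u/2)`, whose squared modulus is `cosh u`. Its real part is
positive, so `θ` stays in the strip where the contour may be shifted. -/
theorem exists_polar_cosh_sinh (u : ℝ) : ∃ θ : ℝ, |θ| < Real.pi / 2 ∧
    √(Real.cosh u) * Real.cos θ = Real.cosh (u / 2) ∧
    √(Real.cosh u) * Real.sin θ = Real.sinh (u / 2) := by
  set w : ℂ := ⟨Real.cosh (u / 2), Real.sinh (u / 2)⟩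
  have hn : ‖w‖ = √(Real.cosh u) := by
    rw [Complex.norm_eq_sqrt_sq_add_sq]
    congr 1
    have := Real.cosh_two_mul (u / 2)
    rw [show 2 * (u / 2) = u by ring] at this
    exact this.symm
  refine ⟨w.arg, Complex.abs_arg_lt_pi_div_two_iff.2 (Or.inl (Real.cosh_pos _)), ?_, ?_⟩
  · rw [← hn, Complex.norm_mul_cos_arg]
  · rw [← hn, Complex.norm_mul_sin_arg]

/-- The product of `exp (-z cosh v) e^{iβv}` and its counterpart at the conjugate point,
convolved at `u`. -/
theorem integral_conj_product {s : ℝ} (hs : 0 < s) (β u : ℝ) :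
    ∫ v : ℝ, (Complex.exp (-(s * (1 + Complex.I)) * Complex.cosh v) *
        Complex.exp (β * v * Complex.I)) *
      (Complex.exp (-(s * (1 - Complex.I)) * Complex.cosh ((u - v : ℝ) : ℂ)) *
        Complex.exp (β * ((u - v : ℝ) : ℂ) * Complex.I)) =
    Complex.exp (β * u * Complex.I) *
      ((∫ v : ℝ, Real.exp (-(2 * s * √(Real.cosh u) * Real.cosh v)) : ℝ) : ℂ) := by
  obtain ⟨θ, hθ, hc, hsn⟩ := exists_polar_cosh_sinh u
  have hR : 0 < √(Real.cosh u) := Real.sqrt_pos.2 (Real.cosh_pos u)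
  -- After `v ↦ v + u/2` the exponent is `-2s (cosh v cosh (u/2) + i sinh v sinh (u/2))`, that is,
  -- `-2s √(cosh u) cosh (v + iθ)`.
  rw [← integral_exp_neg_mul_cosh_add_mul_I (A := 2 * s * √(Real.cosh u)) (by positivity) hθ,
    ← integral_const_mul, ← integral_add_right_eq_self _ (u / 2)]
  congr 1 with v
  rw [Complex.cosh_add_mul_I_eq, mul_mul_mul_comm, ← Complex.exp_add, ← Complex.exp_add,
    mul_comm, show u - (v + u / 2) = u / 2 - v by ring]
  congr 2
  · push_cast; ring
  · have h1 : Complex.cosh ((u / 2 : ℝ) : ℂ) = (√(Real.cosh u) : ℂ) * Complex.cos θ := by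
      rw [← Complex.ofReal_cosh, ← hc]; push_cast; rfl
    have h2 : Complex.sinh ((u / 2 : ℝ) : ℂ) = (√(Real.cosh u) : ℂ) * Complex.sin θ := by
      rw [← Complex.ofReal_sinh, ← hsn]; push_cast; rfl
    rw [Complex.ofReal_add, Complex.ofReal_sub, Complex.cosh_add, Complex.cosh_sub, h1, h2]
    push_cast
    ring

/-- `∫_ℝ exp (-2s √(cosh u) cosh v) dv`, the density of the Fourier representation of
`|K_{iβ}(s(1+i))|²`. -/
noncomputable def coshDensity (s u : ℝ) : ℝ :=
  ∫ v : ℝ, Real.exp (-(2 * s * √(Real.cosh u) * Real.cosh v))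

theorem coshDensity_nonneg (s u : ℝ) : 0 ≤ coshDensity s u :=
  integral_nonneg fun _ => (Real.exp_pos _).le

/-- At `β = 0` the density is itself a convolution of two integrable functions. -/
theorem integrable_coshDensity {s : ℝ} (hs : 0 < s) : Integrable (coshDensity s) := by
  have h := (integrable_cexp_neg_mul_cosh_mul (z := s * (1 + Complex.I))
    (by simpa) 0).integrable_convolution (ContinuousLinearMap.mul ℝ ℂ)
    (integrable_cexp_neg_mul_cosh_mul (z := s * (1 - Complex.I)) (by simpa) 0)
  refine (h.re).congr (ae_of_all _ fun u => ?_)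
  have h' := integral_conj_product hs 0 u
  simp only [convolution_def, ContinuousLinearMap.mul_apply']
  rw [h']
  simp [coshDensity]

theorem besselK_mul_besselK_conj {s : ℝ} (hs : 0 < s) (β : ℝ) :
    besselK (Complex.I * β) (s * (1 + Complex.I)) * besselK (Complex.I * β) (s * (1 - Complex.I)) =
      (∫ u : ℝ, Complex.exp (β * u * Complex.I) * (coshDensity s u : ℂ)) / 4 := by
  have h := integral_convolution (ContinuousLinearMap.mul ℝ ℂ) (μ := volume) (ν := volume)
    (integrable_cexp_neg_mul_cosh_mul (z := s * (1 + Complex.I)) (by simpa) β)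
    (integrable_cexp_neg_mul_cosh_mul (z := s * (1 - Complex.I)) (by simpa) β)
  simp only [convolution_def, ContinuousLinearMap.mul_apply', integral_conj_product hs] at h
  rw [besselK_eq_integral_real (by simpa), besselK_eq_integral_real (by simpa)]
  simp only [coshDensity]
  rw [h]
  ring

theorem kelvinKernel_eq_mul (x τ : ℝ) :
    kelvinKernel x τ =
      besselK (2 * Complex.I * τ) ((2 * (4 * x) ^ (1 / 4 : ℝ) : ℝ) *
        Complex.exp (Real.pi * Complex.I / 4)) *
      besselK (2 * Complex.I * τ) ((2 * (4 * x) ^ (1 / 4 : ℝ) : ℝ) *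
        Complex.exp (-(Real.pi * Complex.I / 4))) := by
  rw [kelvinKernel]
  set μ : ℂ := 2 * Complex.I * τ
  set X : ℝ := 2 * (4 * x) ^ (1 / 4 : ℝ)
  obtain ⟨h1, h2⟩ := kelvin_defining_equations μ X
  have h3 : kelvinKer μ X ^ 2 + kelvinKei μ X ^ 2 = kelvinPlus μ X * kelvinMinus μ X := by
    rw [← h1, ← h2]
    linear_combination ((kelvinKei μ X) ^ 2) * Complex.I_sq
  rw [h3, kelvinPlus, kelvinMinus, mul_mul_mul_comm, ← Complex.exp_add, neg_add_cancel,
    Complex.exp_zero, one_mul]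

theorem kelvinKernel_eq_integral {x : ℝ} (hx : 0 < x) (τ : ℝ) :
    kelvinKernel x τ =
      (∫ u : ℝ, Complex.exp ((2 * τ : ℝ) * u * Complex.I) *
        (coshDensity (2 * x ^ (1 / 4 : ℝ)) u : ℂ)) / 4 := by
  have hs : 0 < 2 * x ^ (1 / 4 : ℝ) := by positivity
  -- The factor `√2` cancels the modulus of `1 ± i`, so that the arguments become `s(1 ± i)`.
  have hX : 2 * (4 * x) ^ (1 / 4 : ℝ) = √2 * (2 * x ^ (1 / 4 : ℝ)) := by
    rw [Real.mul_rpow (by norm_num) hx.le, Real.sqrt_eq_rpow,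
      show (4 : ℝ) = 2 ^ (2 : ℝ) by norm_num, ← Real.rpow_mul (by norm_num)]
    norm_num
    ring
  have h2 : (√2 : ℂ) * √2 = 2 := by
    rw [← Complex.ofReal_mul, Real.mul_self_sqrt (by norm_num)]
    norm_num
  have he : Complex.exp (Real.pi * Complex.I / 4) = √2 / 2 * (1 + Complex.I) := by
    rw [show (Real.pi * Complex.I / 4 : ℂ) = ((Real.pi / 4 : ℝ) : ℂ) * Complex.I by push_cast; ring,
      Complex.exp_mul_I, ← Complex.ofReal_cos, ← Complex.ofReal_sin, Real.cos_pi_div_four,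
      Real.sin_pi_div_four]
    push_cast
    ring
  have he' : Complex.exp (-(Real.pi * Complex.I / 4)) = √2 / 2 * (1 - Complex.I) := by
    rw [show (-(Real.pi * Complex.I / 4) : ℂ) = ((-(Real.pi / 4) : ℝ) : ℂ) * Complex.I by
        push_cast; ring,
      Complex.exp_mul_I, ← Complex.ofReal_cos, ← Complex.ofReal_sin, Real.cos_neg, Real.sin_neg,
      Real.cos_pi_div_four, Real.sin_pi_div_four]
    push_cast
    ring
  rw [kelvinKernel_eq_mul, ← besselK_mul_besselK_conj hs, hX, he, he']
  congr 2
  · push_cast; ring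
  · push_cast; linear_combination (x ^ (1 / 4 : ℝ) : ℝ) * (1 + Complex.I) * h2
  · push_cast; ring
  · push_cast; linear_combination (x ^ (1 / 4 : ℝ) : ℝ) * (1 - Complex.I) * h2

/-! ### Beta and gamma integrals. -/

theorem Real.sigmoid_two_mul (u : ℝ) :
    Real.sigmoid (2 * u) * (1 - Real.sigmoid (2 * u)) = (4 * Real.cosh u ^ 2)⁻¹ := by
  rw [Real.sigmoid_def, Real.cosh_eq, show -(2 * u) = -u + -u by ring, Real.exp_add]
  have h := Real.exp_pos u
  rw [Real.exp_neg]
  field_simp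
  ring

/-- The substitution `t = sigmoid (2u)` maps ℝ onto `(0,1)` with `dt = 2t(1-t) du` and `t(1-t) = (2
cosh u)^{-2}`. It turns the beta density, of total mass 1, into a multiple of `cosh^{-s}`. -/
theorem lintegral_cosh_rpow_neg {s : ℝ} (hs : 0 < s) :
    ∫⁻ u : ℝ, ENNReal.ofReal (Real.cosh u ^ (-s)) =
      ENNReal.ofReal (2 ^ (s - 1) * ProbabilityTheory.beta (s / 2) (s / 2)) := by
  have hh : 0 < s / 2 := half_pos hs
  set B := ProbabilityTheory.beta (s / 2) (s / 2)
  have hB : 0 < B := ProbabilityTheory.beta_pos hh hh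
  set t : ℝ → ℝ := fun u => Real.sigmoid (2 * u)
  have hder : ∀ u ∈ (univ : Set ℝ), HasDerivWithinAt t (t u * (1 - t u) * 2) univ u := by
    intro u _
    have h2 : HasDerivAt (fun u : ℝ => 2 * u) 2 u := by
      simpa using (hasDerivAt_id u).const_mul (2 : ℝ)
    exact ((Real.hasDerivAt_sigmoid (2 * u)).comp u h2).hasDerivWithinAt
  have hinj : InjOn t univ := by
    intro x _ y _ hxy
    have := Real.sigmoid_injective hxy
    linarith
  have himg : t '' univ = Ioo 0 1 := by
    rw [image_univ, ← Real.range_sigmoid]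
    exact (Equiv.mulLeft₀ (2 : ℝ) two_ne_zero).surjective.range_comp Real.sigmoid
  have key := lintegral_image_eq_lintegral_abs_deriv_mul MeasurableSet.univ hder hinj
    (fun x => ENNReal.ofReal (1 / B * x ^ (s / 2 - 1) * (1 - x) ^ (s / 2 - 1)))
  rw [himg, ← ProbabilityTheory.lintegral_betaPDF, ProbabilityTheory.lintegral_betaPDF_eq_one hh hh,
    setLIntegral_univ] at key
  have hpt : ∀ u : ℝ, ENNReal.ofReal |t u * (1 - t u) * 2| *
      ENNReal.ofReal (1 / B * t u ^ (s / 2 - 1) * (1 - t u) ^ (s / 2 - 1)) =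
      ENNReal.ofReal (2 ^ (1 - s) / B) * ENNReal.ofReal (Real.cosh u ^ (-s)) := by
    intro u
    have h0 : 0 < t u := Real.sigmoid_pos _
    have h1 : 0 < 1 - t u := sub_pos.2 (Real.sigmoid_lt_one _)
    have hc := Real.cosh_pos u
    rw [← ENNReal.ofReal_mul (abs_nonneg _), ← ENNReal.ofReal_mul (by positivity)]
    congr 1
    have e1 : t u * (1 - t u) * (t u ^ (s / 2 - 1) * (1 - t u) ^ (s / 2 - 1)) =
        2 ^ (-s) * Real.cosh u ^ (-s) := by
      rw [← Real.mul_rpow h0.le h1.le]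
      have : t u * (1 - t u) = (4 * Real.cosh u ^ 2)⁻¹ := Real.sigmoid_two_mul u
      rw [mul_comm, Real.rpow_sub_one (mul_pos h0 h1).ne', div_mul_cancel₀ _ (mul_pos h0 h1).ne',
        this, Real.inv_rpow (by positivity), ← Real.rpow_neg (by positivity),
        show 4 * Real.cosh u ^ 2 = (2 * Real.cosh u) ^ (2 : ℝ) by norm_cast; ring,
        ← Real.rpow_mul (by positivity), ← Real.mul_rpow (by norm_num) hc.le]
      ring_nf
    rw [abs_of_pos (by positivity), show (1 : ℝ) - s = -s + 1 by ring,
      Real.rpow_add_one (by norm_num)]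
    linear_combination (2 / B) * e1
  simp_rw [hpt] at key
  rw [lintegral_const_mul _ (by fun_prop)] at key
  have hinv : ENNReal.ofReal (2 ^ (s - 1) * B) * ENNReal.ofReal (2 ^ (1 - s) / B) = 1 := by
    rw [← ENNReal.ofReal_mul (by positivity), ← ENNReal.ofReal_one]
    congr 1
    rw [show (1 : ℝ) - s = -(s - 1) by ring, Real.rpow_neg (by norm_num)]
    field_simp
  rw [← one_mul (∫⁻ u : ℝ, _), ← hinv, mul_assoc, ← key, mul_one]

theorem lintegral_rpow_mul_exp_neg_mul_rpow_quarter {b q : ℝ} (hb : 0 < b) (hq : 0 < q) :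
    ∫⁻ x in Ioi (0 : ℝ), ENNReal.ofReal (x ^ (q - 1) * Real.exp (-b * x ^ (1 / 4 : ℝ))) =
      ENNReal.ofReal (b ^ (-(4 * q)) * 4 * Real.Gamma (4 * q)) := by
  have h := integral_rpow_mul_exp_neg_mul_rpow (p := 1 / 4) (q := q - 1) (b := b) (by norm_num)
    (by linarith) hb
  have hpos : 0 < b ^ (-(q - 1 + 1) / (1 / 4)) * (1 / (1 / 4)) *
      Real.Gamma ((q - 1 + 1) / (1 / 4)) := by
    have := Real.Gamma_pos_of_pos (s := (q - 1 + 1) / (1 / 4)) (by rw [sub_add_cancel]; positivity)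
    positivity
  rw [← ofReal_integral_eq_lintegral_ofReal, h]
  · ring_nf
  -- A non-integrable function would have Bochner integral 0, contradicting the positive value in
  -- `h`.
  · by_contra hni
    rw [integral_undef hni] at h
    exact hpos.ne h
  · filter_upwards [ae_restrict_mem measurableSet_Ioi] with x hx
    have : (0 : ℝ) < x := hx
    positivity

/-! ### Hölder's inequality against the exponential. -/

/-- This is `log t ≤ t - 1` at `t = w/b`. It serves as the `q = ∞` endpoint: `w^b e^{-w}` is largest
at `w = b`. -/
theorem exp_neg_mul_rpow_le {b w : ℝ} (hb : 0 < b) (hw : 0 < w) :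
    Real.exp (-w) ≤ (b / Real.exp 1) ^ b * w ^ (-b) := by
  rw [Real.rpow_def_of_pos (by positivity), Real.rpow_def_of_pos hw, ← Real.exp_add,
    Real.log_div hb.ne' (Real.exp_pos 1).ne', Real.log_exp]
  apply Real.exp_le_exp.2
  have h := Real.log_le_sub_one_of_pos (div_pos hw hb)
  rw [Real.log_div hw.ne' hb.ne'] at h
  have h2 := mul_le_mul_of_nonneg_left h hb.le
  have h3 : b * (w / b - 1) = w - b := by field_simp
  nlinarith

theorem gammaFactor_nonneg {ν P : ℝ} (hν : ν < 1) (hP : 1 ≤ P) : 0 ≤ gammaFactor ν P := by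
  have ha : 0 < 1 - ν := sub_pos.2 hν
  unfold gammaFactor
  split_ifs with h
  · positivity
  · have hP1 : 0 < P - 1 := sub_pos.2 (lt_of_le_of_ne hP (Ne.symm h))
    have hP0 : 0 < P := by linarith
    have := Real.Gamma_pos_of_pos (s := 4 * (1 - ν) * (P / (P - 1))) (by positivity)
    positivity

/-- Hölder's inequality for the pairing of `exp (-c x^{1/4})` with a function of `L_{ν,P}`, with the
exact norm of the exponential. -/
theorem lintegral_exp_mul_le {ν P c : ℝ} (hν : ν < 1) (hP : 1 ≤ P) (hc : 0 < c) {φ : ℝ → ℝ≥0∞}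
    (hφ : AEMeasurable φ (volume.restrict (Ioi (0 : ℝ)))) :
    ∫⁻ x in Ioi (0 : ℝ), ENNReal.ofReal (Real.exp (-(c * x ^ (1 / 4 : ℝ)))) * φ x ≤
      ENNReal.ofReal (4 ^ (1 - 1 / P) * gammaFactor ν P * c ^ (-(4 * (1 - ν)))) *
        (∫⁻ x in Ioi (0 : ℝ), (ENNReal.ofReal (x ^ (ν - 1 / P)) * φ x) ^ P) ^ (1 / P) := by
  have ha : 0 < 1 - ν := sub_pos.2 hν
  rcases hP.eq_or_lt with rfl | hP1
  · simp only [gammaFactor, if_true, div_one, sub_self, Real.rpow_zero, one_mul, ENNReal.rpow_one]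
    rw [← lintegral_const_mul' _ _ ENNReal.ofReal_ne_top]
    refine setLIntegral_mono_ae' measurableSet_Ioi (ae_of_all _ fun x hx => ?_)
    have hx : (0 : ℝ) < x := hx
    rw [← mul_assoc, ← ENNReal.ofReal_mul (by positivity)]
    gcongr
    refine (exp_neg_mul_rpow_le (b := 4 * (1 - ν)) (by positivity) (by positivity)).trans_eq ?_
    rw [Real.mul_rpow hc.le (by positivity), ← Real.rpow_mul hx.le, mul_assoc]
    ring_nf
  · have hpq : P.HolderConjugate (P / (P - 1)) := Real.HolderConjugate.conjExponent hP1
    have hg : gammaFactor ν P = (P / (P - 1)) ^ (4 * (ν - 1)) *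
        Real.Gamma (4 * (1 - ν) * (P / (P - 1))) ^ (1 / (P / (P - 1))) := if_neg hP1.ne'
    set q := P / (P - 1)
    have hq : 0 < q := hpq.symm.pos
    have hinv : 1 - 1 / P = 1 / q := by
      have := hpq.inv_add_inv_eq_one
      rw [one_div, one_div]; linarith
    -- The weight is inserted so that the `P`-th power of the second factor is `x^{νP-1} φ^P`, the
    -- integrand of the weighted norm.
    have hsplit : ∫⁻ x in Ioi (0 : ℝ), ENNReal.ofReal (Real.exp (-(c * x ^ (1 / 4 : ℝ)))) * φ x =
        ∫⁻ x in Ioi (0 : ℝ), ((fun x => ENNReal.ofReal (x ^ (1 / P - ν) *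
          Real.exp (-(c * x ^ (1 / 4 : ℝ))))) *
          (fun x => ENNReal.ofReal (x ^ (ν - 1 / P)) * φ x)) x := by
      refine setLIntegral_congr_fun measurableSet_Ioi fun x hx => ?_
      have hx : (0 : ℝ) < x := hx
      simp only [Pi.mul_apply]
      rw [← mul_assoc, ← ENNReal.ofReal_mul (by positivity), mul_right_comm,
        ← Real.rpow_add hx, sub_add_sub_cancel, sub_self, Real.rpow_zero, one_mul]
    rw [hsplit]
    refine (ENNReal.lintegral_mul_le_Lp_mul_Lq _ hpq.symm (Measurable.aemeasurable (by fun_prop))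
      (AEMeasurable.mul (Measurable.aemeasurable (by fun_prop)) hφ)).trans_eq ?_
    congr 1
    have hint : ∫⁻ x in Ioi (0 : ℝ), ENNReal.ofReal (x ^ (1 / P - ν) *
          Real.exp (-(c * x ^ (1 / 4 : ℝ)))) ^ q =
        ∫⁻ x in Ioi (0 : ℝ), ENNReal.ofReal (x ^ ((1 - ν) * q - 1) *
          Real.exp (-(c * q) * x ^ (1 / 4 : ℝ))) := by
      refine setLIntegral_congr_fun measurableSet_Ioi fun x hx => ?_
      have hx : (0 : ℝ) < x := hx
      rw [ENNReal.ofReal_rpow_of_nonneg (by positivity) hq.le,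
        Real.mul_rpow (by positivity) (by positivity), ← Real.rpow_mul hx.le, ← Real.exp_mul]
      -- Conjugacy `1/P = 1 - 1/q` produces the exponent of a gamma integral.
      have hexp : (1 / P - ν) * q = (1 - ν) * q - 1 := by
        have : 1 / P = 1 - 1 / q := by linarith
        rw [this]; field_simp; ring
      rw [hexp]
      ring_nf
    rw [hint, lintegral_rpow_mul_exp_neg_mul_rpow_quarter (by positivity) (by positivity),
      ENNReal.ofReal_rpow_of_nonneg]
    · congr 1
      have hG := Real.Gamma_pos_of_pos (s := 4 * (1 - ν) * q) (by positivity)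
      rw [hg, hinv, show 4 * ((1 - ν) * q) = 4 * (1 - ν) * q by ring,
        Real.mul_rpow (by positivity) hG.le, Real.mul_rpow (by positivity) (by norm_num),
        ← Real.rpow_mul (by positivity),
        show -(4 * (1 - ν) * q) * (1 / q) = -(4 * (1 - ν)) by field_simp,
        Real.mul_rpow hc.le hq.le, show 4 * (ν - 1) = -(4 * (1 - ν)) by ring]
      ring
    · have hG := Real.Gamma_pos_of_pos (s := 4 * ((1 - ν) * q)) (by positivity)
      positivity
    · positivity

/-! ### The weighted spaces. -/

theorem measurable_weight (ν P : ℝ) :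
    Measurable fun x : ℝ => ENNReal.ofReal (x ^ (ν * P - 1)) := by
  fun_prop

/-- The weight is positive on `(0, ∞)`. Hence measurability and almost-everywhere equality pass from
the weighted measure to Lebesgue measure. -/
theorem restrict_absolutelyContinuous_weightedMeasure (ν P : ℝ) :
    volume.restrict (Ioi (0 : ℝ)) ≪ weightedMeasure ν P := by
  refine withDensity_absolutelyContinuous' (measurable_weight ν P).aemeasurable ?_
  filter_upwards [ae_restrict_mem measurableSet_Ioi] with x hx
  exact (ENNReal.ofReal_pos.2 (Real.rpow_pos_of_pos hx _)).ne'

theorem weightedNorm_nonneg (ν P : ℝ) (f : ℝ → ℂ) : 0 ≤ weightedNorm ν P f := by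
  refine Real.rpow_nonneg (setIntegral_nonneg measurableSet_Ioi fun x hx => ?_) _
  have : (0 : ℝ) < x := hx
  positivity

section MemLp

variable {p : ℝ≥0∞} {ν : ℝ} {f : ℝ → ℂ}

theorem MeasureTheory.MemLp.aestronglyMeasurable_restrict_Ioi
    (hf : MemLp f p (weightedMeasure ν p.toReal)) :
    AEStronglyMeasurable f (volume.restrict (Ioi (0 : ℝ))) :=
  hf.1.mono_ac (restrict_absolutelyContinuous_weightedMeasure _ _)

theorem lintegral_enorm_rpow_weightedMeasure (hf : MemLp f p (weightedMeasure ν p.toReal)) :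
    ∫⁻ x, ‖f x‖ₑ ^ p.toReal ∂(weightedMeasure ν p.toReal) =
      ∫⁻ x in Ioi (0 : ℝ), ENNReal.ofReal (‖f x‖ ^ p.toReal * x ^ (ν * p.toReal - 1)) := by
  rw [weightedMeasure, lintegral_withDensity_eq_lintegral_mul₀ (measurable_weight _ _).aemeasurable
    (hf.aestronglyMeasurable_restrict_Ioi.enorm.pow_const _)]
  refine setLIntegral_congr_fun measurableSet_Ioi fun x _ => ?_
  simp only [Pi.mul_apply]
  rw [ENNReal.ofReal_mul (by positivity), mul_comm, ← ofReal_norm,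
    ENNReal.ofReal_rpow_of_nonneg (norm_nonneg _) ENNReal.toReal_nonneg]

/-- `weightedNorm` uses a Bochner integral, which is 0 on divergence; `MemLp` excludes that case. -/
theorem ofReal_weightedNorm [Fact (1 ≤ p)] (hp : p ≠ ∞)
    (hf : MemLp f p (weightedMeasure ν p.toReal)) :
    ENNReal.ofReal (weightedNorm ν p.toReal f) =
      (∫⁻ x, ‖f x‖ₑ ^ p.toReal ∂(weightedMeasure ν p.toReal)) ^ (1 / p.toReal) := by
  have hp0 : p ≠ 0 := (zero_lt_one.trans_le (Fact.out : 1 ≤ p)).ne'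
  have hlt := (eLpNorm_lt_top_iff_lintegral_rpow_enorm_lt_top hp0 hp).1 hf.2
  rw [lintegral_enorm_rpow_weightedMeasure hf] at hlt ⊢
  have hnn : 0 ≤ᵐ[volume.restrict (Ioi (0 : ℝ))]
      fun x => ‖f x‖ ^ p.toReal * x ^ (ν * p.toReal - 1) := by
    filter_upwards [ae_restrict_mem measurableSet_Ioi] with x hx
    have : (0 : ℝ) < x := hx
    positivity
  have hm : AEStronglyMeasurable (fun x => ‖f x‖ ^ p.toReal * x ^ (ν * p.toReal - 1))
      (volume.restrict (Ioi (0 : ℝ))) :=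
    ((hf.aestronglyMeasurable_restrict_Ioi.norm.aemeasurable.pow_const _).mul
      (Measurable.aemeasurable (by fun_prop))).aestronglyMeasurable
  have hi := (lintegral_ofReal_ne_top_iff_integrable hm hnn).1 hlt.ne
  rw [weightedNorm, ← ENNReal.ofReal_rpow_of_nonneg (integral_nonneg_of_ae hnn) (by positivity),
    ofReal_integral_eq_lintegral_ofReal hi hnn]

theorem ofReal_weightedNorm_eq_lintegral [Fact (1 ≤ p)] (hp : p ≠ ∞)
    (hf : MemLp f p (weightedMeasure ν p.toReal)) :
    (∫⁻ x in Ioi (0 : ℝ), (ENNReal.ofReal (x ^ (ν - 1 / p.toReal)) * ‖f x‖ₑ) ^ p.toReal) ^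
      (1 / p.toReal) = ENNReal.ofReal (weightedNorm ν p.toReal f) := by
  have hp0 : p ≠ 0 := (zero_lt_one.trans_le (Fact.out : 1 ≤ p)).ne'
  have hP : 0 < p.toReal := ENNReal.toReal_pos hp0 hp
  rw [ofReal_weightedNorm hp hf, lintegral_enorm_rpow_weightedMeasure hf]
  congr 1
  refine setLIntegral_congr_fun measurableSet_Ioi fun x hx => ?_
  have hx : (0 : ℝ) < x := hx
  rw [ENNReal.mul_rpow_of_nonneg _ _ hP.le, ENNReal.ofReal_rpow_of_nonneg (by positivity) hP.le,
    ← ofReal_norm, ENNReal.ofReal_rpow_of_nonneg (norm_nonneg _) hP.le,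
    ← ENNReal.ofReal_mul (by positivity), ← Real.rpow_mul hx.le, mul_comm, sub_mul,
    div_mul_cancel₀ _ hP.ne']

theorem weightedNorm_toReal_eq_norm_toLp [Fact (1 ≤ p)] (hp : p ≠ ∞)
    (hf : MemLp f p (weightedMeasure ν p.toReal)) :
    weightedNorm ν p.toReal f = ‖hf.toLp f‖ := by
  have hp0 : p ≠ 0 := (zero_lt_one.trans_le (Fact.out : 1 ≤ p)).ne'
  rw [Lp.norm_toLp, eLpNorm_eq_lintegral_rpow_enorm_toReal hp0 hp, ← ofReal_weightedNorm hp hf,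
    ENNReal.toReal_ofReal (weightedNorm_nonneg _ _ _)]

end MemLp

/-! ### Measurability, size, continuity and decay of the kernel. -/

theorem aestronglyMeasurable_kelvinKernel (τ : ℝ) :
    AEStronglyMeasurable (fun x => kelvinKernel x τ) (volume.restrict (Ioi (0 : ℝ))) := by
  have hd : StronglyMeasurable fun w : ℝ × ℝ => coshDensity (2 * w.1 ^ (1 / 4 : ℝ)) w.2 := by
    have : Continuous fun z : (ℝ × ℝ) × ℝ =>
        Real.exp (-(2 * (2 * z.1.1 ^ (1 / 4 : ℝ)) * √(Real.cosh z.1.2) * Real.cosh z.2)) := by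
      have h := Real.continuous_rpow_const (q := 1 / 4) (by norm_num)
      have := h.comp (continuous_fst.comp (continuous_fst (X := ℝ × ℝ) (Y := ℝ)))
      simp only [Function.comp_def] at this
      fun_prop
    exact this.stronglyMeasurable.integral_prod_right'
  have h : StronglyMeasurable fun x : ℝ =>
      (∫ u : ℝ, Complex.exp ((2 * τ : ℝ) * u * Complex.I) *
        (coshDensity (2 * x ^ (1 / 4 : ℝ)) u : ℂ)) / 4 := by
    have h2 : StronglyMeasurable fun w : ℝ × ℝ => Complex.exp ((2 * τ : ℝ) * w.2 * Complex.I) *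
        (coshDensity (2 * w.1 ^ (1 / 4 : ℝ)) w.2 : ℂ) :=
      (Continuous.stronglyMeasurable (by fun_prop)).mul
        (Complex.continuous_ofReal.comp_stronglyMeasurable hd)
    exact (continuous_id.div_const (4 : ℂ)).comp_stronglyMeasurable h2.integral_prod_right'
  refine h.aestronglyMeasurable.congr ?_
  filter_upwards [ae_restrict_mem measurableSet_Ioi] with x hx
  exact (kelvinKernel_eq_integral hx τ).symm

/-- The Fourier transform of a nonnegative function is largest in modulus at the origin. -/
theorem norm_kelvinKernel_le {x : ℝ} (hx : 0 < x) (τ : ℝ) :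
    ‖kelvinKernel x τ‖ ≤ ‖kelvinKernel x 0‖ := by
  have h0 : kelvinKernel x 0 = (((∫ u : ℝ, coshDensity (2 * x ^ (1 / 4 : ℝ)) u) / 4 : ℝ) : ℂ) := by
    rw [kelvinKernel_eq_integral hx, Complex.ofReal_div, ← integral_complex_ofReal]
    simp
  rw [h0, Complex.norm_real, Real.norm_of_nonneg
    (div_nonneg (integral_nonneg (coshDensity_nonneg _)) (by norm_num)),
    kelvinKernel_eq_integral hx, norm_div, Complex.norm_ofNat]
  gcongr
  refine (norm_integral_le_integral_norm _).trans_eq (integral_congr_ae (ae_of_all _ fun u => ?_))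
  simp only
  rw [norm_mul, ← Complex.ofReal_mul, Complex.norm_exp_ofReal_mul_I, one_mul, Complex.norm_real,
    Real.norm_of_nonneg (coshDensity_nonneg _ _)]

theorem continuous_kelvinKernel {x : ℝ} (hx : 0 < x) : Continuous (kelvinKernel x) := by
  rw [show kelvinKernel x = _ from funext (kelvinKernel_eq_integral hx)]
  refine Continuous.div_const ?_ _
  have hi := integrable_coshDensity (s := 2 * x ^ (1 / 4 : ℝ)) (by positivity)
  refine continuous_of_dominated (bound := coshDensity (2 * x ^ (1 / 4 : ℝ))) (fun τ => ?_)
    (fun τ => ae_of_all _ fun u => ?_) hi (ae_of_all _ fun u => by fun_prop)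
  · exact (Continuous.aestronglyMeasurable (by fun_prop)).mul
      (Complex.continuous_ofReal.comp_aestronglyMeasurable hi.aestronglyMeasurable)
  · rw [norm_mul, ← Complex.ofReal_mul, Complex.norm_exp_ofReal_mul_I, one_mul, Complex.norm_real,
      Real.norm_of_nonneg (coshDensity_nonneg _ _)]

theorem tendsto_kelvinKernel {x : ℝ} (hx : 0 < x) : Tendsto (kelvinKernel x) atTop (𝓝 0) := by
  have h := Real.tendsto_integral_exp_smul_cocompact
    (fun u : ℝ => (coshDensity (2 * x ^ (1 / 4 : ℝ)) u : ℂ))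
  -- The Fourier character is `e^{-2πiuw}`, so frequency `w = -τ/π` yields `e^{2iτu}`.
  have hw : Tendsto (fun τ : ℝ => -(τ / Real.pi)) atTop (cocompact ℝ) :=
    (tendsto_neg_atTop_atBot.comp (tendsto_id.atTop_div_const Real.pi_pos)).mono_right
      atBot_le_cocompact
  have h2 := (h.comp hw).div_const 4
  rw [zero_div] at h2
  refine h2.congr fun τ => ?_
  rw [kelvinKernel_eq_integral hx, Function.comp_apply]
  congr 2 with u
  rw [Circle.smul_def, Real.fourierChar_apply, smul_eq_mul]
  congr 3
  rw [← Complex.ofReal_mul]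
  congr 1
  have := Real.pi_ne_zero
  field_simp

/-- An extended-valued form with nonnegative integrand, ready for Tonelli. -/
theorem enorm_kelvinKernel_le {x : ℝ} (hx : 0 < x) (τ : ℝ) :
    ‖kelvinKernel x τ‖ₑ ≤ ENNReal.ofReal (1 / 4) * ∫⁻ w : ℝ × ℝ,
      ENNReal.ofReal (Real.exp (-(4 * √(Real.cosh w.1) * Real.cosh w.2 * x ^ (1 / 4 : ℝ)))) := by
  rw [kelvinKernel_eq_integral hx, div_eq_inv_mul, enorm_mul, Measure.volume_eq_prod,
    lintegral_prod _ (Measurable.aemeasurable (by fun_prop))]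
  refine mul_le_mul' (le_of_eq ?_) ((enorm_integral_le_lintegral_enorm _).trans
    (lintegral_mono fun u => ?_))
  · rw [← ofReal_norm]; norm_num
  · rw [enorm_mul, ← Complex.ofReal_mul, ← ofReal_norm, Complex.norm_exp_ofReal_mul_I,
      ENNReal.ofReal_one, one_mul, ← ofReal_norm, Complex.norm_real, ofReal_norm]
    refine (enorm_integral_le_lintegral_enorm _).trans_eq (lintegral_congr fun v => ?_)
    rw [← ofReal_norm, Real.norm_of_nonneg (Real.exp_pos _).le]
    ring_nf

theorem sqrt_cosh_mul_cosh_rpow (a u v : ℝ) :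
    (4 * √(Real.cosh u) * Real.cosh v) ^ (-(4 * a)) =
      4 ^ (-(4 * a)) * (Real.cosh u ^ (-(2 * a)) * Real.cosh v ^ (-(4 * a))) := by
  have hu := Real.cosh_pos u
  have hv := Real.cosh_pos v
  rw [Real.mul_rpow (by positivity) hv.le, Real.mul_rpow (by norm_num) (by positivity),
    Real.sqrt_eq_rpow, ← Real.rpow_mul hu.le]
  ring_nf

/-- The constant as the estimate produces it: 1/4 from the two halves of `besselK`, the Hölder
factor, the power of 4 from `c`, and the two `cosh` integrals. -/
theorem boundConst_eq {ν P : ℝ} :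
    boundConst ν P = 1 / 4 * (4 ^ (1 - 1 / P) * gammaFactor ν P * 4 ^ (-(4 * (1 - ν))) *
      ((2 ^ (2 * (1 - ν) - 1) * ProbabilityTheory.beta (1 - ν) (1 - ν)) *
        (2 ^ (4 * (1 - ν) - 1) *
          ProbabilityTheory.beta (2 * (1 - ν)) (2 * (1 - ν))))) := by
  have h : (4 : ℝ) ^ (ν - 3 + (1 - 1 / P)) = 1 / 4 * (4 ^ (1 - 1 / P) * 4 ^ (-(4 * (1 - ν))) *
      (2 ^ (2 * (1 - ν) - 1) * 2 ^ (4 * (1 - ν) - 1))) := by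
    have h14 : (1 / 4 : ℝ) = 2 ^ (-2 : ℝ) := by
      rw [Real.rpow_neg (by norm_num)]; norm_num
    rw [h14, show (4 : ℝ) = 2 ^ (2 : ℝ) by norm_num]
    simp only [← Real.rpow_mul (show (0 : ℝ) ≤ 2 by norm_num),
      ← Real.rpow_add (show (0 : ℝ) < 2 by norm_num)]
    congr 1
    ring_nf
  rw [boundConst, h]
  ring

theorem boundConst_nonneg {ν P : ℝ} (hν : ν < 1) (hP : 1 ≤ P) : 0 ≤ boundConst ν P := by
  have ha : 0 < 1 - ν := sub_pos.2 hν
  have h1 := ProbabilityTheory.beta_pos ha ha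
  have h2 := ProbabilityTheory.beta_pos (mul_pos two_pos ha) (mul_pos two_pos ha)
  have h3 := gammaFactor_nonneg hν hP
  unfold boundConst
  positivity

/-! ### Bounds, continuity and decay of the transform. -/

section Transform

variable {p : ℝ≥0∞} {ν : ℝ} {f g : ℝ → ℂ}

theorem lintegral_kelvinKernel_mul_le [Fact (1 ≤ p)] (hp : p ≠ ∞) (hν : ν < 1)
    (hf : MemLp f p (weightedMeasure ν p.toReal)) (τ : ℝ) :
    ∫⁻ x in Ioi (0 : ℝ), ‖kelvinKernel x τ * f x‖ₑ ≤
      ENNReal.ofReal (boundConst ν p.toReal * weightedNorm ν p.toReal f) := by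
  have hP : 1 ≤ p.toReal := by
    simpa using ENNReal.toReal_mono hp (Fact.out : 1 ≤ p)
  have ha : 0 < 1 - ν := sub_pos.2 hν
  set D : ℝ := 4 ^ (1 - 1 / p.toReal) * gammaFactor ν p.toReal
  have hD : 0 ≤ D := mul_nonneg (by positivity) (gammaFactor_nonneg hν hP)
  have hφ := hf.aestronglyMeasurable_restrict_Ioi.enorm
  calc ∫⁻ x in Ioi (0 : ℝ), ‖kelvinKernel x τ * f x‖ₑ
      ≤ ∫⁻ x in Ioi (0 : ℝ), ENNReal.ofReal (1 / 4) * ∫⁻ w : ℝ × ℝ,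
          ENNReal.ofReal (Real.exp (-(4 * √(Real.cosh w.1) * Real.cosh w.2 * x ^ (1 / 4 : ℝ)))) *
            ‖f x‖ₑ := by
        refine setLIntegral_mono_ae' measurableSet_Ioi (ae_of_all _ fun x hx => ?_)
        rw [enorm_mul, lintegral_mul_const _ (by fun_prop), ← mul_assoc]
        exact mul_le_mul_left (enorm_kelvinKernel_le hx τ) _
    _ = ENNReal.ofReal (1 / 4) * ∫⁻ w : ℝ × ℝ, ∫⁻ x in Ioi (0 : ℝ),
          ENNReal.ofReal (Real.exp (-(4 * √(Real.cosh w.1) * Real.cosh w.2 * x ^ (1 / 4 : ℝ)))) *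
            ‖f x‖ₑ := by
        rw [lintegral_const_mul' _ _ ENNReal.ofReal_ne_top, lintegral_lintegral_swap]
        exact AEMeasurable.mul (Measurable.aemeasurable (by fun_prop))
          (hφ.comp_quasiMeasurePreserving Measure.quasiMeasurePreserving_fst)
    -- Hölder in `x` for each fixed `w = (u, v)`; only the factor depending on `w` remains to be
    -- integrated.
    _ ≤ ENNReal.ofReal (1 / 4) * ∫⁻ w : ℝ × ℝ,
          ENNReal.ofReal (D * (4 * √(Real.cosh w.1) * Real.cosh w.2) ^ (-(4 * (1 - ν)))) *
            ENNReal.ofReal (weightedNorm ν p.toReal f) := by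
        gcongr with w
        have hu := Real.cosh_pos w.1
        have hv := Real.cosh_pos w.2
        rw [← ofReal_weightedNorm_eq_lintegral hp hf]
        exact lintegral_exp_mul_le hν hP (by positivity) hφ
    _ = ENNReal.ofReal (boundConst ν p.toReal * weightedNorm ν p.toReal f) := by
        have hpt : ∀ w : ℝ × ℝ,
            ENNReal.ofReal (D * (4 * √(Real.cosh w.1) * Real.cosh w.2) ^ (-(4 * (1 - ν)))) =
            ENNReal.ofReal (D * 4 ^ (-(4 * (1 - ν)))) *
              (ENNReal.ofReal (Real.cosh w.1 ^ (-(2 * (1 - ν)))) *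
                ENNReal.ofReal (Real.cosh w.2 ^ (-(4 * (1 - ν))))) := by
          intro w
          have hu := Real.cosh_pos w.1
          have hv := Real.cosh_pos w.2
          rw [sqrt_cosh_mul_cosh_rpow, ← ENNReal.ofReal_mul (by positivity),
            ← ENNReal.ofReal_mul (by positivity)]
          congr 1
          ring
        have h1 := ProbabilityTheory.beta_pos ha ha
        have h2 := ProbabilityTheory.beta_pos (mul_pos two_pos ha) (mul_pos two_pos ha)
        simp_rw [hpt]
        rw [lintegral_mul_const' _ _ ENNReal.ofReal_ne_top,
          lintegral_const_mul' _ _ ENNReal.ofReal_ne_top, Measure.volume_eq_prod,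
          lintegral_prod_mul (f := fun u => ENNReal.ofReal (Real.cosh u ^ (-(2 * (1 - ν)))))
            (g := fun v => ENNReal.ofReal (Real.cosh v ^ (-(4 * (1 - ν))))) (Measurable.aemeasurable (by fun_prop))
            (Measurable.aemeasurable (by fun_prop)),
          lintegral_cosh_rpow_neg (by positivity), lintegral_cosh_rpow_neg (by positivity),
          show 2 * (1 - ν) / 2 = 1 - ν by ring, show 4 * (1 - ν) / 2 = 2 * (1 - ν) by ring,
          ← ENNReal.ofReal_mul (by positivity), ← ENNReal.ofReal_mul (by positivity),
          ← ENNReal.ofReal_mul (by positivity), ← ENNReal.ofReal_mul (by positivity),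
          ← mul_assoc, ← boundConst_eq]

theorem integrableOn_kelvinKernel_mul [Fact (1 ≤ p)] (hp : p ≠ ∞) (hν : ν < 1)
    (hf : MemLp f p (weightedMeasure ν p.toReal)) (τ : ℝ) :
    IntegrableOn (fun x => kelvinKernel x τ * f x) (Ioi (0 : ℝ)) :=
  ⟨(aestronglyMeasurable_kelvinKernel τ).mul hf.aestronglyMeasurable_restrict_Ioi,
    (lintegral_kelvinKernel_mul_le hp hν hf τ).trans_lt ENNReal.ofReal_lt_top⟩

theorem norm_indexTransform_le [Fact (1 ≤ p)] (hp : p ≠ ∞) (hν : ν < 1)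
    (hf : MemLp f p (weightedMeasure ν p.toReal)) (τ : ℝ) :
    ‖indexTransform f τ‖ ≤ boundConst ν p.toReal * weightedNorm ν p.toReal f := by
  have hP : 1 ≤ p.toReal := by
    simpa using ENNReal.toReal_mono hp (Fact.out : 1 ≤ p)
  have h := (enorm_integral_le_lintegral_enorm _).trans (lintegral_kelvinKernel_mul_le hp hν hf τ)
  rw [← ofReal_norm] at h
  exact (ENNReal.ofReal_le_ofReal_iff
    (mul_nonneg (boundConst_nonneg hν hP) (weightedNorm_nonneg _ _ _))).1 h

/-- The common majorant, independent of `τ`, for both uses of dominated convergence. -/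
theorem norm_kelvinKernel_mul_le_ae (f : ℝ → ℂ) (τ : ℝ) :
    ∀ᵐ x ∂(volume.restrict (Ioi (0 : ℝ))),
      ‖kelvinKernel x τ * f x‖ ≤ ‖kelvinKernel x 0 * f x‖ := by
  filter_upwards [ae_restrict_mem measurableSet_Ioi] with x hx
  rw [norm_mul, norm_mul]
  exact mul_le_mul_of_nonneg_right (norm_kelvinKernel_le hx τ) (norm_nonneg _)

theorem continuous_indexTransform [Fact (1 ≤ p)] (hp : p ≠ ∞) (hν : ν < 1)
    (hf : MemLp f p (weightedMeasure ν p.toReal)) : Continuous (indexTransform f) := by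
  refine continuous_of_dominated (bound := fun x => ‖kelvinKernel x 0 * f x‖)
    (fun τ => (integrableOn_kelvinKernel_mul hp hν hf τ).1)
    (fun τ => norm_kelvinKernel_mul_le_ae f τ) (integrableOn_kelvinKernel_mul hp hν hf 0).norm ?_
  filter_upwards [ae_restrict_mem measurableSet_Ioi] with x hx
  exact (continuous_kelvinKernel hx).mul_const _

theorem tendsto_indexTransform [Fact (1 ≤ p)] (hp : p ≠ ∞) (hν : ν < 1)
    (hf : MemLp f p (weightedMeasure ν p.toReal)) : Tendsto (indexTransform f) atTop (𝓝 0) := by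
  rw [← integral_zero ℝ ℂ (μ := volume.restrict (Ioi (0 : ℝ)))]
  refine tendsto_integral_filter_of_dominated_convergence (fun x => ‖kelvinKernel x 0 * f x‖)
    (Eventually.of_forall fun τ => (integrableOn_kelvinKernel_mul hp hν hf τ).1)
    (Eventually.of_forall fun τ => norm_kelvinKernel_mul_le_ae f τ)
    (integrableOn_kelvinKernel_mul hp hν hf 0).norm ?_
  filter_upwards [ae_restrict_mem measurableSet_Ioi] with x hx
  simpa using (tendsto_kelvinKernel hx).mul_const (f x)

/-- Makes the transform well defined on classes, as linearity on `Lp` requires. -/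
theorem indexTransform_congr_ae {P : ℝ} (h : f =ᵐ[weightedMeasure ν P] g) :
    indexTransform f = indexTransform g := by
  ext τ
  refine integral_congr_ae ?_
  filter_upwards [(restrict_absolutelyContinuous_weightedMeasure ν P).ae_le h] with x hx
  rw [hx]

end Transform

/-! ### The bounded operator and the main theorem. -/

/-- The index transform as a bounded operator from `L_{ν,p}` to the bounded continuous functions. -/
noncomputable def indexTransformCLM (p : ℝ≥0∞) [Fact (1 ≤ p)] (hp : p ≠ ∞) (ν : ℝ) (hν : ν < 1) :
    Lp ℂ p (weightedMeasure ν p.toReal) →L[ℂ] (ℝ →ᵇ ℂ) :=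
  LinearMap.mkContinuous
    { toFun := fun f => BoundedContinuousFunction.ofNormedAddCommGroup (indexTransform f)
        (continuous_indexTransform hp hν (Lp.memLp f)) _
        (norm_indexTransform_le hp hν (Lp.memLp f))
      map_add' := fun f g => by
        ext τ
        simp only [BoundedContinuousFunction.coe_ofNormedAddCommGroup,
          BoundedContinuousFunction.coe_add, Pi.add_apply]
        rw [indexTransform_congr_ae (Lp.coeFn_add f g), indexTransform, indexTransform,
          indexTransform,
          ← integral_add (integrableOn_kelvinKernel_mul hp hν (Lp.memLp f) τ)
            (integrableOn_kelvinKernel_mul hp hν (Lp.memLp g) τ)]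
        simp [mul_add]
      map_smul' := fun c f => by
        ext τ
        simp only [BoundedContinuousFunction.coe_ofNormedAddCommGroup, RingHom.id_apply,
          BoundedContinuousFunction.coe_smul]
        rw [indexTransform_congr_ae (Lp.coeFn_smul c f), indexTransform, indexTransform,
          ← integral_smul]
        simp [mul_left_comm] }
    (boundConst ν p.toReal) fun f => by
      have hP : 1 ≤ p.toReal := by
        simpa using ENNReal.toReal_mono hp (Fact.out : 1 ≤ p)
      have h : weightedNorm ν p.toReal f = ‖f‖ := by
        rw [weightedNorm_toReal_eq_norm_toLp hp (Lp.memLp f), Lp.toLp_coeFn]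
      refine (BoundedContinuousFunction.norm_le
        (mul_nonneg (boundConst_nonneg hν hP) (norm_nonneg f))).2 fun τ => ?_
      rw [← h]
      exact norm_indexTransform_le hp hν (Lp.memLp f) τ

theorem indexTransformCLM_apply (p : ℝ≥0∞) [Fact (1 ≤ p)] (hp : p ≠ ∞) (ν : ℝ) (hν : ν < 1)
    (f : Lp ℂ p (weightedMeasure ν p.toReal)) (τ : ℝ) :
    indexTransformCLM p hp ν hν f τ = indexTransform f τ := rfl

theorem theorem2 (p : ℝ≥0∞) [Fact (1 ≤ p)] (hp : p ≠ ∞) (ν : ℝ) (hν : ν < 1) :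
    ∃ T : Lp ℂ p (weightedMeasure ν p.toReal) →L[ℂ] (ℝ →ᵇ ℂ),
      ∀ (f : ℝ → ℂ) (hf : MemLp f p (weightedMeasure ν p.toReal)),
        (∀ τ : ℝ, IntegrableOn (fun x => kelvinKernel x τ * f x) (Ioi (0 : ℝ)) volume ∧
          T (hf.toLp f) τ = indexTransform f τ) ∧
        ‖T (hf.toLp f)‖ ≤ boundConst ν p.toReal * weightedNorm ν p.toReal f ∧
        Tendsto (indexTransform f) atTop (𝓝 0) := by
  have hP : 1 ≤ p.toReal := by
    simpa using ENNReal.toReal_mono hp (Fact.out : 1 ≤ p)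
  refine ⟨indexTransformCLM p hp ν hν, fun f hf => ?_⟩
  have happ : ∀ τ : ℝ, indexTransformCLM p hp ν hν (hf.toLp f) τ = indexTransform f τ := fun τ => by
    rw [indexTransformCLM_apply, indexTransform_congr_ae hf.coeFn_toLp]
  refine ⟨fun τ => ⟨integrableOn_kelvinKernel_mul hp hν hf τ, happ τ⟩,
    (BoundedContinuousFunction.norm_le
      (mul_nonneg (boundConst_nonneg hν hP) (weightedNorm_nonneg _ _ _))).2 fun τ => ?_,
    tendsto_indexTransform hp hν hf⟩
  rw [happ]
  exact norm_indexTransform_le hp hν hf τ
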